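/- A source sends packets $k=0,1,2,\dots$ over a channel to a server, which computes them one at a time in order of arrival, without preemption. The transmission times $T_k>0$ are i.i.d., the computation times $C_k>0$ are i.i.d., both have arbitrary given distributions with finite means, and the two sequences are independent. Packet $k$ is submitted at time $S_k$, where $S_0=-T_0-C_0$ and $S_{k+1}=S_k+Z_k$; it is delivered at $D_k=S_k+T_k+W_k+C_k$, where $W_0=0$ and $W_{k+1}=\max\{0,\,D_k-S_{k+1}-T_{k+1}\}$ is its waiting time at the server. Its peak age of information (PAoI) is $P_k=(S_k-S_{k-1})+(D_k-S_k)$ for $k\ge 1$. A feasible policy is a (possibly randomized) rule that chooses the inter-generation times $Z_k$, $k\ge 0$, such that $Z_k\ge T_k+W_k$ (the channel is idle and the queue is empty at each submission) and such that the choice is causal: the decision to submit packet $k+1$ at a given instant depends only on $T_0,\dots,T_k$, $C_0,\dots,C_{k-1}$, on randomization independent of all transmission and computation times, and on what has been observed of $C_k$ by that instant (its value if packet $k$ has been delivered by then; otherwise only that its computation is still going on). The average PAoI of a policy $\pi$ is $\mathcal P_\pi=\lim_{K\to\infty}\frac1K\,\mathbb E_\pi\big[\sum_{k=1}^K P_k\big]$;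 where the limit does not exist, it is read as the limit inferior. Theorem. For all such distributions of the transmission and computation times there is a randomized threshold policy, i.e. a feasible policy with $$Z_k=T_k+W_k+\min\{\Theta_k,C_k\}\qquad(k\ge 0),$$ where the thresholds $\Theta_k\in[0,\infty]$ are i.i.d. and independent of all transmission and computation times, which is optimal: its average PAoI exists as a finite limit and is minimal among the average PAoIs of all feasible policies. -/

import Mathlib

open MeasureTheory ProbabilityTheory Filter Topology
open scoped ENNReal NNReal

noncomputable section

namespace MEC

/-! ### Sample paths of the non-preemptive system

A sample path is given by the inter-generation times `z k`, the transmission times `t k` and the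
computation times `c k` of the packets `k = 0, 1, 2, …`. -/

/-- Submission times: `S 0 = - T 0 - C 0` and `S (k+1) = S k + Z k`. -/
def submitTime (z t c : ℕ → ℝ) : ℕ → ℝ
  | 0 => -t 0 - c 0
  | k + 1 => submitTime z t c k + z k

/-- Waiting times in the queue of the server (first come, first served, no preemption):
`W 0 = 0` and `W (k+1) = max {0, D k - S (k+1) - T (k+1)}`, where
`D k = S k + T k + W k + C k`. -/
def waitTime (z t c : ℕ → ℝ) : ℕ → ℝ
  | 0 => 0
  | k + 1 =>
      max 0 ((submitTime z t c k + t k + waitTime z t c k + c k)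
        - submitTime z t c (k + 1) - t (k + 1))

/-- Delivery times: `D k = S k + T k + W k + C k`. -/
def deliveryTime (z t c : ℕ → ℝ) (k : ℕ) : ℝ :=
  submitTime z t c k + t k + waitTime z t c k + c k

/-- The `k`-th peak age (meaningful for `k ≥ 1`): the inter-generation time
`X k = S k - S (k-1)` plus the system time `A k = D k - S k`. -/
def peakAge (z t c : ℕ → ℝ) (k : ℕ) : ℝ :=
  (submitTime z t c k - submitTime z t c (k - 1)) + (deliveryTime z t c k - submitTime z t c k)

/-! ### Policies -/

/-- A (possibly randomized) rule for choosing the inter-generation times. The source has a random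
seed, on an arbitrary probability space, drawn independently of all the transmission and
computation times; the rule gives the inter-generation time `Z k` as a measurable function of the
seed and of the transmission and computation times. What the rule may really look at is restricted
by `Policy.IsCausal`. -/
structure Policy where
  /-- the space of seeds -/
  Seed : Type
  /-- its events -/
  seedSpace : MeasurableSpace Seed
  /-- the law of the seed -/
  seedLaw : Measure Seed
  /-- the law of the seed is a probability measure -/
  isProb : IsProbabilityMeasure seedLaw
  /-- `Z k u t c` is the time from the submission of packet `k` to that of packet `k+1` -/
  Z : ℕ → Seed → (ℕ → ℝ) → (ℕ → ℝ) → ℝ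
  /-- measurability of the rule -/
  measurable_Z : ∀ k, Measurable fun x : Seed × (ℕ → ℝ) × (ℕ → ℝ) => Z k x.1 x.2.1 x.2.2

attribute [instance] Policy.seedSpace Policy.isProb

namespace Policy

/-- The inter-generation times of a policy along a sample path. -/
def path (π : Policy) (u : π.Seed) (t c : ℕ → ℝ) : ℕ → ℝ := fun k => π.Z k u t c

/-- The waiting time `W k` of packet `k` under a policy. -/
def W (π : Policy) (k : ℕ) (u : π.Seed) (t c : ℕ → ℝ) : ℝ := waitTime (π.path u t c) t c k

/-- The time from the instant at which the server starts to compute packet `k`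
to the submission of packet `k+1`, i.e. `Z k - T k - W k`. -/
def lag (π : Policy) (k : ℕ) (u : π.Seed) (t c : ℕ → ℝ) : ℝ :=
  π.Z k u t c - t k - π.W k u t c

/-- Causality. When packet `k+1` is submitted, the source knows its seed, the past
`T 0, …, T k, C 0, …, C (k-1)`, and of `C k` only what it has seen on the feedback link: its value if
packet `k` has been delivered by then, and otherwise merely that its computation is still going on.
So two situations which share the seed and that past, and which have either the same `C k` or
both a computation of packet `k` that is still going on at the instant of submission in the first
of them, lead to the same decision. -/
def IsCausal (π : Policy) : Prop :=
  ∀ (k : ℕ) (u : π.Seed) (t t' c c' : ℕ → ℝ),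
    (∀ j, 0 < t j) → (∀ j, 0 < t' j) → (∀ j, 0 < c j) → (∀ j, 0 < c' j) →
    (∀ j ≤ k, t j = t' j) → (∀ j < k, c j = c' j) →
    (c k = c' k ∨ (π.lag k u t c < c k ∧ π.lag k u t c < c' k)) →
    π.Z k u t c = π.Z k u t' c'

/-- Feasibility: packets are submitted only when the channel is idle and the queue is empty,
`Z k ≥ T k + W k`. -/
def IsFeasible (π : Policy) : Prop :=
  ∀ (k : ℕ) (u : π.Seed) (t c : ℕ → ℝ), (∀ j, 0 < t j) → (∀ j, 0 < c j) →
    t k + π.W k u t c ≤ π.Z k u t c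

end Policy

/-- The set `Π` of all causal feasible policies. -/
def feasiblePolicies : Set Policy := {π | π.IsCausal ∧ π.IsFeasible}

/-- The set of continuous working policies: `Z k ≤ T k + W k + C k` for all `k`. -/
def continuousWorkingPolicies : Set Policy :=
  {π | π ∈ feasiblePolicies ∧
    ∀ (k : ℕ) (u : π.Seed) (t c : ℕ → ℝ), (∀ j, 0 < t j) → (∀ j, 0 < c j) →
      π.Z k u t c ≤ t k + π.W k u t c + c k}

/-- The set of randomized threshold policies: the seed provides thresholds `Θ k ∈ [0, ∞]`,
independent and with one and the same law, and `Z k = T k + W k + min {Θ k, C k}`. -/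
def randomizedThresholdPolicies : Set Policy :=
  {π | π ∈ continuousWorkingPolicies ∧
    ∃ (ν : Measure ℝ≥0∞) (Θ : ℕ → π.Seed → ℝ≥0∞),
      (∀ k, Measurable (Θ k)) ∧ (∀ k, π.seedLaw.map (Θ k) = ν) ∧ iIndepFun Θ π.seedLaw ∧
      ∀ (k : ℕ) (u : π.Seed) (t c : ℕ → ℝ), (∀ j, 0 < t j) → (∀ j, 0 < c j) →
        π.Z k u t c = t k + π.W k u t c + (min (Θ k u) (ENNReal.ofReal (c k))).toReal}

/-! ### The average peak age -/

/-- `(1 / K) E_π [∑ k = 1, …, K, P k]`, where the transmission times are i.i.d. with law `μT`, the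
computation times are i.i.d. with law `μC`, and both sequences and the seed are independent. The
peak ages of a feasible policy are nonnegative; the expectation may be infinite. -/
def meanPeakAge (μT μC : Measure ℝ) [IsProbabilityMeasure μT] [IsProbabilityMeasure μC]
    (π : Policy) (K : ℕ) : ℝ≥0∞ :=
  (∫⁻ x : π.Seed × (ℕ → ℝ) × (ℕ → ℝ),
      ENNReal.ofReal (∑ k ∈ Finset.Icc 1 K, peakAge (π.path x.1 x.2.1 x.2.2) x.2.1 x.2.2 k)
    ∂(π.seedLaw.prod
      ((Measure.infinitePi fun _ : ℕ => μT).prod (Measure.infinitePi fun _ : ℕ => μC)))) / K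

/-- A policy in `Π` is optimal if its average peak age `lim (1 / K) E_π [∑ P k]` exists and is
finite and no policy in `Π` has a smaller one; for policies for which the limit does not exist, the
limit inferior is taken. -/
def IsOptimal (μT μC : Measure ℝ) [IsProbabilityMeasure μT] [IsProbabilityMeasure μC]
    (π : Policy) : Prop :=
  π ∈ feasiblePolicies ∧
    ∃ p : ℝ≥0, Tendsto (meanPeakAge μT μC π) atTop (𝓝 (p : ℝ≥0∞)) ∧
      ∀ π' ∈ feasiblePolicies, (p : ℝ≥0∞) ≤ liminf (meanPeakAge μT μC π') atTop

end MEC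

end

open MeasureTheory ProbabilityTheory Filter Topology
open scoped ENNReal NNReal

noncomputable section

namespace MEC

/-! Write the lag $L_k = Z_k - T_k - W_k \ge 0$. Every waiting time enters the sum of the peak ages
twice, once in a system time and once in the next inter-generation time. Up to the last waiting
time, the sum therefore splits into terms fixed by the distributions and the costs $L_k + 2\max(0,
C_k - L_k - T_{k+1})$ (`sum_peakAge_add_waitTime`). No state is carried from one decision to the
next, so a one-step problem remains.

Given the seed and the past, a causal lag is a function of $C_k$ that cannot distinguish
computations still running. It is thus constant until it is overtaken by the delivery, and waiting
past the delivery gains nothing, so some threshold does at least as well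
(`exists_threshold_le_stepCost`). Resampling $T_{k+1}$ and $C_k$ transfers this to expectations
(`le_lintegral_cost`).

The expected cost is continuous in the threshold on the compact space $[0,\infty]$, so a minimizer
exists. Using it at every step attains the lower bound; the leftover $\mathbb E[W_K]/K \le \mathbb
E[C]/K$ vanishes. -/

/-! ### Decomposition of the peak age along a sample path -/

/-- The cost of submitting a packet `l` after the start of the previous computation, which takes the
time `c`, when the transmission takes the time `t`: the lag and twice the ensuing waiting time. -/
def stepCost (l t c : ℝ) : ℝ := l + 2 * max 0 (c - l - t)

/-- The lag of the threshold `θ` when the computation time is `c`. -/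
def thresholdLag (θ : ℝ≥0∞) (c : ℝ) : ℝ := (min θ (ENNReal.ofReal c)).toReal

theorem waitTime_succ (z t c : ℕ → ℝ) (k : ℕ) :
    waitTime z t c (k + 1) = max 0 (c k - (z k - t k - waitTime z t c k) - t (k + 1)) := by
  simp only [waitTime, submitTime]
  congr 1
  ring

theorem waitTime_nonneg (z t c : ℕ → ℝ) (k : ℕ) : 0 ≤ waitTime z t c k := by
  cases k with
  | zero => exact le_rfl
  | succ k => exact le_max_left _ _

theorem stepCost_nonneg {l : ℝ} (hl : 0 ≤ l) (t c : ℝ) : 0 ≤ stepCost l t c := by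
  unfold stepCost
  positivity

theorem peakAge_succ (z t c : ℕ → ℝ) (k : ℕ) :
    peakAge z t c (k + 1) = z k + t (k + 1) + waitTime z t c (k + 1) + c (k + 1) := by
  simp only [peakAge, deliveryTime, submitTime, Nat.add_sub_cancel]
  ring

/-- `W k` occurs in the `k`-th peak age and, through `z k`, in the next one. Since `W 0 = 0`, adding
`W K` completes the last pair, which explains the factor 2 in `stepCost`. -/
theorem sum_peakAge_add_waitTime (z t c : ℕ → ℝ) (K : ℕ) :
    ∑ k ∈ Finset.Icc 1 K, peakAge z t c k + waitTime z t c K =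
      ∑ k ∈ Finset.range K, (t k + t (k + 1) + c (k + 1) +
        stepCost (z k - t k - waitTime z t c k) (t (k + 1)) (c k)) := by
  induction K with
  | zero => simp [waitTime]
  | succ K ih =>
    rw [Finset.sum_Icc_succ_top (by omega), Finset.sum_range_succ, ← ih, peakAge_succ, stepCost,
      ← waitTime_succ]
    ring

theorem thresholdLag_nonneg (θ : ℝ≥0∞) (c : ℝ) : 0 ≤ thresholdLag θ c := ENNReal.toReal_nonneg

theorem thresholdLag_le (θ : ℝ≥0∞) {c : ℝ} (hc : 0 ≤ c) : thresholdLag θ c ≤ c := by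
  refine (ENNReal.toReal_mono ENNReal.ofReal_ne_top (min_le_right _ _)).trans ?_
  rw [ENNReal.toReal_ofReal hc]

theorem thresholdLag_top {c : ℝ} (hc : 0 ≤ c) : thresholdLag ⊤ c = c := by
  simp [thresholdLag, hc]

theorem thresholdLag_ofReal {θ c : ℝ} (hθ : 0 ≤ θ) (hc : 0 ≤ c) :
    thresholdLag (ENNReal.ofReal θ) c = min θ c := by
  rw [thresholdLag, ← ENNReal.ofReal_min, ENNReal.toReal_ofReal (le_min hθ hc)]

theorem eq_top_or_ofReal (θ : ℝ≥0∞) : θ = ⊤ ∨ ∃ r : ℝ, 0 ≤ r ∧ θ = ENNReal.ofReal r := by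
  rcases eq_or_ne θ ⊤ with h | h
  · exact Or.inl h
  · exact Or.inr ⟨θ.toReal, ENNReal.toReal_nonneg, (ENNReal.ofReal_toReal h).symm⟩

theorem thresholdLag_congr {θ : ℝ≥0∞} {c c' : ℝ} (hc : 0 < c) (hc' : 0 < c')
    (h : thresholdLag θ c < c) (h' : thresholdLag θ c < c') :
    thresholdLag θ c = thresholdLag θ c' := by
  rcases eq_top_or_ofReal θ with rfl | ⟨r, hr, rfl⟩
  · rw [thresholdLag_top hc.le] at h
    exact absurd h (lt_irrefl _)
  · rw [thresholdLag_ofReal hr hc.le] at h h' ⊢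
    rw [thresholdLag_ofReal hr hc'.le]
    grind

/-- A causal choice of the lag, as a function of the running computation time, costs at least as
much as some threshold. -/
theorem exists_threshold_le_stepCost {L : ℝ → ℝ} (hL : ∀ c, 0 < c → 0 ≤ L c)
    (hcausal : ∀ c c', 0 < c → 0 < c' → L c < c → L c < c' → L c = L c') :
    ∃ θ : ℝ≥0∞, ∀ c, 0 < c → ∀ t, 0 < t →
      stepCost (thresholdLag θ c) t c ≤ stepCost (L c) t c := by
  -- Once the computation is over the next packet finds the server idle, so further delay only adds
  -- to the lag.
  have late : ∀ c t, 0 < t → c ≤ L c → stepCost c t c ≤ stepCost (L c) t c := by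
    intro c t ht h
    rw [stepCost, stepCost, max_eq_left (by linarith), max_eq_left (by linarith)]
    linarith
  by_cases h : ∃ c₀, 0 < c₀ ∧ L c₀ < c₀
  · obtain ⟨c₀, hc₀, hlt⟩ := h
    -- A single submission before delivery fixes the threshold: causality gives the same lag for
    -- every computation longer than `L c₀`.
    refine ⟨ENNReal.ofReal (L c₀), fun c hc t ht => ?_⟩
    rw [thresholdLag_ofReal (hL c₀ hc₀) hc.le]
    rcases lt_or_ge (L c₀) c with h1 | h1
    · rw [min_eq_left h1.le, hcausal c₀ c hc₀ hc hlt h1]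
    · rw [min_eq_right h1]
      -- If `L c < c ≤ L c₀ < c₀`, causality would force `L c = L c₀ ≥ c`.
      refine late c t ht (le_of_not_gt fun h2 => ?_)
      have := hcausal c c₀ hc hc₀ h2 (by linarith)
      linarith
  · push Not at h
    refine ⟨⊤, fun c hc t ht => ?_⟩
    rw [thresholdLag_top hc.le]
    exact late c t ht (h c hc)

/-! ### The expected cost of a threshold -/

/-- The minimum with a finite value stays away from `⊤`, the only point where `toReal` is
discontinuous. -/
theorem continuous_thresholdLag (c : ℝ) : Continuous fun θ => thresholdLag θ c := by
  refine continuous_iff_continuousAt.2 fun θ => ?_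
  refine (ENNReal.tendsto_toReal ?_).comp (continuous_id.min continuous_const).continuousAt
  exact ((min_le_right _ _).trans_lt ENNReal.ofReal_lt_top).ne

theorem measurable_stepCost : Measurable fun x : ℝ × ℝ × ℝ => stepCost x.1 x.2.1 x.2.2 := by
  unfold stepCost
  fun_prop

theorem measurable_thresholdLag : Measurable fun x : ℝ≥0∞ × ℝ => thresholdLag x.1 x.2 := by
  unfold thresholdLag
  fun_prop

theorem measurable_thresholdCost : Measurable fun x : ℝ≥0∞ × ℝ × ℝ =>
    ENNReal.ofReal (stepCost (thresholdLag x.1 x.2.2) x.2.1 x.2.2) :=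
  (measurable_stepCost.comp ((measurable_thresholdLag.comp
    (measurable_fst.prodMk (measurable_snd.comp measurable_snd))).prodMk
      measurable_snd)).ennreal_ofReal

/-- The expected cost of the threshold `θ`. -/
def thresholdCost (μT μC : Measure ℝ) (θ : ℝ≥0∞) : ℝ≥0∞ :=
  ∫⁻ p : ℝ × ℝ, ENNReal.ofReal (stepCost (thresholdLag θ p.2) p.1 p.2) ∂μT.prod μC

theorem ae_pos_prod {μT μC : Measure ℝ} (hT : ∀ᵐ x ∂μT, 0 < x) (hC : ∀ᵐ x ∂μC, 0 < x) :
    ∀ᵐ p ∂μT.prod μC, 0 < p.1 ∧ 0 < p.2 :=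
  (Measure.quasiMeasurePreserving_fst.ae hT).and (Measure.quasiMeasurePreserving_snd.ae hC)

theorem lintegral_ofReal_ne_top {μ : Measure ℝ} (h : Integrable (fun x : ℝ => x) μ) :
    ∫⁻ x, ENNReal.ofReal x ∂μ ≠ ⊤ :=
  ((lintegral_mono fun x => Real.ofReal_le_enorm x).trans_lt h.2).ne

section Threshold

variable {μT μC : Measure ℝ} [IsProbabilityMeasure μT] [IsProbabilityMeasure μC]

/-- The cost is either the lag, at most `c`, or `2 * c` minus the lag and `2 * t`. The bound is
uniform in `θ`, hence serves for dominated convergence. -/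
theorem stepCost_thresholdLag_le (θ : ℝ≥0∞) {t c : ℝ} (ht : 0 < t) (hc : 0 < c) :
    stepCost (thresholdLag θ c) t c ≤ 2 * c := by
  have h0 := thresholdLag_nonneg θ c
  have h1 := thresholdLag_le θ hc.le
  unfold stepCost
  rcases max_cases 0 (c - thresholdLag θ c - t) with h | h <;> linarith

theorem lintegral_two_mul_snd_ne_top (hC_mean : Integrable (fun x : ℝ => x) μC) :
    ∫⁻ p : ℝ × ℝ, ENNReal.ofReal (2 * p.2) ∂μT.prod μC ≠ ⊤ := by
  have h := (measurePreserving_snd (μ := μT) (ν := μC)).lintegral_comp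
    (f := fun x : ℝ => ENNReal.ofReal (2 * x)) (by fun_prop)
  rw [h]
  simp_rw [ENNReal.ofReal_mul (zero_le_two (α := ℝ))]
  rw [lintegral_const_mul _ (by fun_prop)]
  exact ENNReal.mul_ne_top ENNReal.ofReal_ne_top (lintegral_ofReal_ne_top hC_mean)

theorem measurable_thresholdCost_right (θ : ℝ≥0∞) : Measurable fun p : ℝ × ℝ =>
    ENNReal.ofReal (stepCost (thresholdLag θ p.2) p.1 p.2) :=
  measurable_thresholdCost.comp measurable_prodMk_left

theorem thresholdCost_ne_top (hT : ∀ᵐ x ∂μT, 0 < x) (hC : ∀ᵐ x ∂μC, 0 < x)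
    (hC_mean : Integrable (fun x : ℝ => x) μC) (θ : ℝ≥0∞) : thresholdCost μT μC θ ≠ ⊤ := by
  refine ne_top_of_le_ne_top (lintegral_two_mul_snd_ne_top (μT := μT) hC_mean) (lintegral_mono_ae ?_)
  filter_upwards [ae_pos_prod hT hC] with p hp
  exact ENNReal.ofReal_le_ofReal (stepCost_thresholdLag_le θ hp.1 hp.2)

theorem continuous_thresholdCost (hT : ∀ᵐ x ∂μT, 0 < x) (hC : ∀ᵐ x ∂μC, 0 < x)
    (hC_mean : Integrable (fun x : ℝ => x) μC) : Continuous (thresholdCost μT μC) := by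
  refine continuous_iff_continuousAt.2 fun θ => ?_
  refine tendsto_lintegral_filter_of_dominated_convergence
    (fun p => ENNReal.ofReal (2 * p.2)) (Eventually.of_forall measurable_thresholdCost_right)
    (Eventually.of_forall fun θ' => ?_) (lintegral_two_mul_snd_ne_top hC_mean)
    (Eventually.of_forall fun p => ?_)
  · filter_upwards [ae_pos_prod hT hC] with p hp
    exact ENNReal.ofReal_le_ofReal (stepCost_thresholdLag_le θ' hp.1 hp.2)
  · refine ENNReal.tendsto_ofReal (Continuous.tendsto ?_ θ)
    have := continuous_thresholdLag p.2
    unfold stepCost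
    fun_prop

/-- Compactness needs the threshold `⊤`, which means always awaiting delivery. -/
theorem exists_thresholdCost_le (hT : ∀ᵐ x ∂μT, 0 < x) (hC : ∀ᵐ x ∂μC, 0 < x)
    (hC_mean : Integrable (fun x : ℝ => x) μC) :
    ∃ θ, ∀ θ', thresholdCost μT μC θ ≤ thresholdCost μT μC θ' := by
  obtain ⟨θ, -, hθ⟩ := isCompact_univ.exists_isMinOn Set.univ_nonempty
    (continuous_thresholdCost hT hC hC_mean).continuousOn
  exact ⟨θ, fun θ' => hθ (Set.mem_univ θ')⟩

end Threshold

/-! ### Resampling one coordinate of an i.i.d. sequence -/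

/-- Redrawing a coordinate independently leaves a product law unchanged, as is seen on boxes.
Conditioning on the other coordinates thereby becomes an inner integral over the fresh value. -/
theorem measurePreserving_update {ι : Type*} [DecidableEq ι] {X : ι → Type*}
    [∀ i, MeasurableSpace (X i)] (μ : ∀ i, Measure (X i)) [∀ i, IsProbabilityMeasure (μ i)]
    (i : ι) :
    MeasurePreserving (fun p : (∀ j, X j) × X i => Function.update p.1 i p.2)
      ((Measure.infinitePi μ).prod (μ i)) (Measure.infinitePi μ) := by
  refine ⟨measurable_update', Measure.eq_infinitePi _ fun s t ht => ?_⟩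
  rw [Measure.map_apply measurable_update'
    (MeasurableSet.pi s.countable_toSet fun j _ => ht j)]
  by_cases hi : i ∈ s
  · have : (fun p : (∀ j, X j) × X i => Function.update p.1 i p.2) ⁻¹' (Set.pi s t) =
        (Set.pi ((s.erase i : Finset ι) : Set ι) t) ×ˢ (t i) := by
      ext p
      simp only [Set.mem_preimage, Set.mem_pi, Set.mem_prod, Finset.coe_erase, Finset.mem_coe,
        Set.mem_sdiff, Set.mem_singleton_iff]
      constructor
      · intro h
        refine ⟨fun j hj => ?_, by simpa using h i hi⟩
        simpa [Function.update_of_ne hj.2] using h j hj.1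
      · rintro ⟨h, h'⟩ j hj
        by_cases hji : j = i
        · subst hji
          simpa using h'
        · simpa [Function.update_of_ne hji] using h j ⟨hj, hji⟩
    rw [this, Measure.prod_prod, Measure.infinitePi_pi _ fun j _ => ht j,
      Finset.prod_erase_mul _ _ hi]
  · have : (fun p : (∀ j, X j) × X i => Function.update p.1 i p.2) ⁻¹' (Set.pi s t) =
        (Set.pi s t) ×ˢ Set.univ := by
      ext p
      simp only [Set.mem_preimage, Set.mem_pi, Set.mem_prod, Finset.mem_coe, Set.mem_univ,
        and_true]
      refine forall₂_congr fun j hj => ?_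
      rw [Function.update_of_ne (ne_of_mem_of_not_mem hj hi)]
    rw [this, Measure.prod_prod, Measure.infinitePi_pi _ fun j _ => ht j, measure_univ, mul_one]

/-- This separates the sample paths, with laws `μ` and `ρ`, from the fresh coordinates, with laws
`ν` and `σ`. -/
theorem lintegral_prod_prod_comm {α β γ δ : Type*} [MeasurableSpace α] [MeasurableSpace β]
    [MeasurableSpace γ] [MeasurableSpace δ] (μ : Measure α) (ν : Measure β) (ρ : Measure γ)
    (σ : Measure δ) [SFinite μ] [SFinite ν] [SFinite ρ] [SFinite σ]
    {G : (α × β) × γ × δ → ℝ≥0∞} (hG : Measurable G) :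
    ∫⁻ q, G q ∂(μ.prod ν).prod (ρ.prod σ) =
      ∫⁻ y, ∫⁻ p, G ((y.1, p.1), y.2, p.2) ∂ν.prod σ ∂μ.prod ρ := by
  have h1 : Measurable fun y : α × γ => ∫⁻ p, G ((y.1, p.1), y.2, p.2) ∂ν.prod σ :=
    Measurable.lintegral_prod_right' (f := fun q : (α × γ) × β × δ =>
      G ((q.1.1, q.2.1), q.1.2, q.2.2)) (by fun_prop)
  rw [lintegral_prod _ hG.aemeasurable, lintegral_prod _ hG.lintegral_prod_right'.aemeasurable,
    lintegral_prod _ h1.aemeasurable]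
  refine lintegral_congr fun a => ?_
  have h2 : Measurable fun q : β × γ => ∫⁻ x, G ((a, q.1), q.2, x) ∂σ :=
    Measurable.lintegral_prod_right' (f := fun q : (β × γ) × δ =>
      G ((a, q.1.1), q.1.2, q.2)) (by fun_prop)
  calc ∫⁻ s, ∫⁻ r, G ((a, s), r) ∂ρ.prod σ ∂ν
      = ∫⁻ s, ∫⁻ b, ∫⁻ x, G ((a, s), b, x) ∂σ ∂ρ ∂ν := by
        refine lintegral_congr fun s => ?_
        exact lintegral_prod _ (hG.comp measurable_prodMk_left).aemeasurable
    _ = ∫⁻ b, ∫⁻ s, ∫⁻ x, G ((a, s), b, x) ∂σ ∂ν ∂ρ := lintegral_lintegral_swap h2.aemeasurable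
    _ = ∫⁻ b, ∫⁻ p, G ((a, p.1), b, p.2) ∂ν.prod σ ∂ρ := by
        refine lintegral_congr fun b => ?_
        exact (lintegral_prod (fun p : β × δ => G ((a, p.1), b, p.2))
          (Measurable.aemeasurable (by fun_prop))).symm

theorem ae_forall_pos_infinitePi {μ : Measure ℝ} [IsProbabilityMeasure μ]
    (h : ∀ᵐ x ∂μ, 0 < x) : ∀ᵐ x ∂Measure.infinitePi fun _ : ℕ => μ, ∀ j, 0 < x j :=
  ae_all_iff.2 fun j =>
    (measurePreserving_eval_infinitePi (fun _ : ℕ => μ) j).quasiMeasurePreserving.ae h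

/-! ### Policies -/

namespace Policy

theorem measurable_W (π : Policy) (k : ℕ) :
    Measurable fun x : π.Seed × (ℕ → ℝ) × (ℕ → ℝ) => π.W k x.1 x.2.1 x.2.2 := by
  induction k with
  | zero => exact measurable_const
  | succ k ih =>
    have hZ := π.measurable_Z k
    have : (fun x : π.Seed × (ℕ → ℝ) × (ℕ → ℝ) => π.W (k + 1) x.1 x.2.1 x.2.2) = fun x =>
        max 0 (x.2.2 k - (π.Z k x.1 x.2.1 x.2.2 - x.2.1 k - π.W k x.1 x.2.1 x.2.2)
          - x.2.1 (k + 1)) := by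
      funext x
      exact waitTime_succ _ _ _ k
    rw [this]
    fun_prop

theorem measurable_lag (π : Policy) (k : ℕ) :
    Measurable fun x : π.Seed × (ℕ → ℝ) × (ℕ → ℝ) => π.lag k x.1 x.2.1 x.2.2 := by
  have hZ := π.measurable_Z k
  have hW := π.measurable_W k
  unfold lag
  fun_prop

/-- The cost of the decision on packet `k + 1`. -/
def cost (π : Policy) (k : ℕ) (x : π.Seed × (ℕ → ℝ) × (ℕ → ℝ)) : ℝ≥0∞ :=
  ENNReal.ofReal (stepCost (π.lag k x.1 x.2.1 x.2.2) (x.2.1 (k + 1)) (x.2.2 k))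

theorem measurable_cost (π : Policy) (k : ℕ) : Measurable (π.cost k) := by
  have hL := π.measurable_lag k
  unfold cost stepCost
  fun_prop

/-- The joint law of the seed, the transmission times and the computation times. -/
abbrev jointLaw (π : Policy) (μT μC : Measure ℝ) [IsProbabilityMeasure μT]
    [IsProbabilityMeasure μC] : Measure (π.Seed × (ℕ → ℝ) × (ℕ → ℝ)) :=
  π.seedLaw.prod
    ((Measure.infinitePi fun _ : ℕ => μT).prod (Measure.infinitePi fun _ : ℕ => μC))

theorem lag_nonneg {π : Policy} (h : π.IsFeasible) (k : ℕ) (u : π.Seed) {t c : ℕ → ℝ}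
    (ht : ∀ j, 0 < t j) (hc : ∀ j, 0 < c j) : 0 ≤ π.lag k u t c := by
  have := h k u t c ht hc
  unfold lag
  linarith

/-- The waiting time of packet `k` depends only on what is known before its computation starts. -/
theorem W_congr {π : Policy} (h : π.IsCausal) (k : ℕ) (u : π.Seed) {t t' c c' : ℕ → ℝ}
    (ht : ∀ j, 0 < t j) (ht' : ∀ j, 0 < t' j) (hc : ∀ j, 0 < c j) (hc' : ∀ j, 0 < c' j)
    (htt : ∀ j ≤ k, t j = t' j) (hcc : ∀ j < k, c j = c' j) :
    π.W k u t c = π.W k u t' c' := by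
  induction k with
  | zero => rfl
  | succ k ih =>
    have hW := ih (fun j hj => htt j (by omega)) (fun j hj => hcc j (by omega))
    -- For packet `k + 1` the value `c k` already belongs to the common past.
    have hZ := h k u t t' c c' ht ht' hc hc' (fun j hj => htt j (by omega))
      (fun j hj => hcc j (by omega)) (Or.inl (hcc k (by omega)))
    unfold W at hW ⊢
    rw [waitTime_succ, waitTime_succ, hW, htt (k + 1) le_rfl, htt k (by omega), hcc k (by omega)]
    simp only [path, hZ]

/-- Given the seed and the past, the decision of a causal policy costs at least as much as some
threshold. -/
theorem exists_thresholdCost_le_lintegral {μT μC : Measure ℝ} {π : Policy}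
    (hπ : π ∈ feasiblePolicies)
    (hT : ∀ᵐ x ∂μT, 0 < x) (hC : ∀ᵐ x ∂μC, 0 < x) (k : ℕ) (u : π.Seed) {t c : ℕ → ℝ}
    (ht : ∀ j, 0 < t j) (hc : ∀ j, 0 < c j) :
    ∃ θ, thresholdCost μT μC θ ≤ ∫⁻ p : ℝ × ℝ,
      π.cost k (u, Function.update t (k + 1) p.1, Function.update c k p.2) ∂μT.prod μC := by
  have hupd : ∀ {a : ℕ → ℝ} (i : ℕ) {x : ℝ}, (∀ j, 0 < a j) → 0 < x →
      ∀ j, 0 < Function.update a i x j := by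
    intro a i x ha hx j
    by_cases h : j = i
    · subst h
      simpa using hx
    · simpa [Function.update_of_ne h] using ha j
  have hupd_lt : ∀ x y : ℝ, ∀ j < k, Function.update c k x j = Function.update c k y j := by
    intro x y j hj
    rw [Function.update_of_ne hj.ne, Function.update_of_ne hj.ne]
  obtain ⟨θ, hθ⟩ := exists_threshold_le_stepCost
    (L := fun x => π.lag k u t (Function.update c k x))
    (fun x hx => lag_nonneg hπ.2 k u ht (hupd k hc hx))
    (fun x y hx hy h h' => by
      have hZ := hπ.1 k u t t (Function.update c k x) (Function.update c k y) ht ht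
        (hupd k hc hx) (hupd k hc hy) (fun _ _ => rfl) (hupd_lt x y)
        (Or.inr ⟨by simpa using h, by simpa using h'⟩)
      have hW := W_congr hπ.1 k u ht ht (hupd k hc hx) (hupd k hc hy) (fun _ _ => rfl)
        (hupd_lt x y)
      simp only [lag, hZ, hW])
  refine ⟨θ, lintegral_mono_ae ?_⟩
  filter_upwards [ae_pos_prod hT hC] with p hp
  have htt : ∀ j ≤ k, Function.update t (k + 1) p.1 j = t j := fun j hj =>
    Function.update_of_ne (by omega) _ _
  -- The decision precedes any knowledge of `T (k + 1)`, so one threshold serves for all its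
  -- resampled values.
  have hlag : π.lag k u (Function.update t (k + 1) p.1) (Function.update c k p.2) =
      π.lag k u t (Function.update c k p.2) := by
    have hZ := hπ.1 k u _ t _ _ (hupd (k + 1) ht hp.1) ht (hupd k hc hp.2) (hupd k hc hp.2) htt
      (fun _ _ => rfl) (Or.inl rfl)
    have hW := W_congr hπ.1 k u (hupd (k + 1) ht hp.1) ht (hupd k hc hp.2) (hupd k hc hp.2) htt
      (fun _ _ => rfl)
    simp only [lag, hZ, hW, htt k le_rfl]
  simp only [cost, hlag, Function.update_self]
  exact ENNReal.ofReal_le_ofReal (hθ p.2 hp.2 p.1 hp.1)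

/-- The mean of two transmission times, a computation time and a decision of cost `m`. -/
def meanAge (μT μC : Measure ℝ) (m : ℝ≥0∞) : ℝ≥0∞ :=
  ∫⁻ y, ENNReal.ofReal y ∂μT + ∫⁻ y, ENNReal.ofReal y ∂μT + ∫⁻ y, ENNReal.ofReal y ∂μC + m

theorem tendsto_meanAge_sub {μT μC : Measure ℝ} (hC_mean : Integrable (fun x : ℝ => x) μC)
    (m : ℝ≥0∞) :
    Tendsto (fun K : ℕ => meanAge μT μC m - (∫⁻ y, ENNReal.ofReal y ∂μC) / K) atTop
      (𝓝 (meanAge μT μC m)) := by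
  have h := ENNReal.Tendsto.sub
    (tendsto_const_nhds (x := meanAge μT μC m) (f := (atTop : Filter ℕ)))
    (ENNReal.Tendsto.const_div ENNReal.tendsto_nat_nhds_top
      (Or.inr (lintegral_ofReal_ne_top hC_mean))) (Or.inr (by simp))
  simpa using h

/-! ### Upper and lower bounds on the mean peak age -/

section Bounds

variable {μT μC : Measure ℝ} [IsProbabilityMeasure μT] [IsProbabilityMeasure μC]

theorem ae_pos_jointLaw (π : Policy) (hT : ∀ᵐ x ∂μT, 0 < x) (hC : ∀ᵐ x ∂μC, 0 < x) :
    ∀ᵐ x ∂π.jointLaw μT μC, (∀ j, 0 < x.2.1 j) ∧ ∀ j, 0 < x.2.2 j :=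
  Measure.quasiMeasurePreserving_snd.ae
    ((Measure.quasiMeasurePreserving_fst.ae (ae_forall_pos_infinitePi hT)).and
      (Measure.quasiMeasurePreserving_snd.ae (ae_forall_pos_infinitePi hC)))

theorem lintegral_transmission (π : Policy) (k : ℕ) :
    ∫⁻ x, ENNReal.ofReal (x.2.1 k) ∂π.jointLaw μT μC = ∫⁻ y, ENNReal.ofReal y ∂μT :=
  ((measurePreserving_eval_infinitePi (fun _ : ℕ => μT) k).comp
    (measurePreserving_fst.comp measurePreserving_snd)).lintegral_comp
      (f := fun y : ℝ => ENNReal.ofReal y) (by fun_prop)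

theorem lintegral_computation (π : Policy) (k : ℕ) :
    ∫⁻ x, ENNReal.ofReal (x.2.2 k) ∂π.jointLaw μT μC = ∫⁻ y, ENNReal.ofReal y ∂μC :=
  ((measurePreserving_eval_infinitePi (fun _ : ℕ => μC) k).comp
    (measurePreserving_snd.comp measurePreserving_snd)).lintegral_comp
      (f := fun y : ℝ => ENNReal.ofReal y) (by fun_prop)

theorem le_lintegral_cost {π : Policy} (hπ : π ∈ feasiblePolicies) (hT : ∀ᵐ x ∂μT, 0 < x)
    (hC : ∀ᵐ x ∂μC, 0 < x) {m : ℝ≥0∞} (hm : ∀ θ, m ≤ thresholdCost μT μC θ) (k : ℕ) :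
    m ≤ ∫⁻ x, π.cost k x ∂π.jointLaw μT μC := by
  have hmeas := π.measurable_cost k
  have hu : ∀ u : π.Seed, m ≤ ∫⁻ y, π.cost k (u, y)
      ∂(Measure.infinitePi fun _ : ℕ => μT).prod (Measure.infinitePi fun _ : ℕ => μC) := by
    intro u
    have hmu : Measurable fun y => π.cost k (u, y) := hmeas.comp measurable_prodMk_left
    have hT_upd := measurePreserving_update (fun _ : ℕ => μT) (k + 1)
    have hC_upd := measurePreserving_update (fun _ : ℕ => μC) k
    -- With `T (k + 1)` and `C k` redrawn, the inner integral is the expected cost given the seed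
    -- and the other coordinates, which is at least that of some threshold.
    rw [← (hT_upd.prod hC_upd).lintegral_comp hmu]
    refine le_of_le_of_eq ?_
      (lintegral_prod_prod_comm _ _ _ _ (hmu.comp (hT_upd.prod hC_upd).measurable)).symm
    calc m = ∫⁻ _, m ∂(Measure.infinitePi fun _ : ℕ => μT).prod
          (Measure.infinitePi fun _ : ℕ => μC) := by simp
      _ ≤ _ := by
        refine lintegral_mono_ae ?_
        filter_upwards [Measure.quasiMeasurePreserving_fst.ae (ae_forall_pos_infinitePi hT),
          Measure.quasiMeasurePreserving_snd.ae (ae_forall_pos_infinitePi hC)] with y h1 h2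
        obtain ⟨θ, hθ⟩ := exists_thresholdCost_le_lintegral hπ hT hC k u h1 h2
        exact (hm θ).trans hθ
  rw [lintegral_prod _ hmeas.aemeasurable]
  calc m = ∫⁻ _, m ∂π.seedLaw := by simp
    _ ≤ _ := lintegral_mono hu

/-- The average peak age, up to the waiting time of the last packet, is the average cost. -/
theorem lintegral_peakAge_add_waitTime {π : Policy} (hπ : π.IsFeasible) (hT : ∀ᵐ x ∂μT, 0 < x)
    (hC : ∀ᵐ x ∂μC, 0 < x) (K : ℕ) :
    ∫⁻ x, ENNReal.ofReal
        (∑ k ∈ Finset.Icc 1 K, peakAge (π.path x.1 x.2.1 x.2.2) x.2.1 x.2.2 k) ∂π.jointLaw μT μC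
      + ∫⁻ x, ENNReal.ofReal (π.W K x.1 x.2.1 x.2.2) ∂π.jointLaw μT μC =
    ∑ k ∈ Finset.range K, (∫⁻ y, ENNReal.ofReal y ∂μT + ∫⁻ y, ENNReal.ofReal y ∂μT
      + ∫⁻ y, ENNReal.ofReal y ∂μC + ∫⁻ x, π.cost k x ∂π.jointLaw μT μC) := by
  have hW := π.measurable_W K
  rw [← lintegral_add_right _ (by fun_prop)]
  calc _ = ∫⁻ x, ∑ k ∈ Finset.range K, (ENNReal.ofReal (x.2.1 k) + ENNReal.ofReal (x.2.1 (k + 1))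
          + ENNReal.ofReal (x.2.2 (k + 1)) + π.cost k x) ∂π.jointLaw μT μC := by
        refine lintegral_congr_ae ?_
        filter_upwards [π.ae_pos_jointLaw hT hC] with x ⟨ht, hc⟩
        have hcost : ∀ k, 0 ≤ stepCost (π.lag k x.1 x.2.1 x.2.2) (x.2.1 (k + 1)) (x.2.2 k) :=
          fun k => stepCost_nonneg (lag_nonneg hπ k x.1 ht hc) _ _
        have hpeak : ∀ k ∈ Finset.Icc 1 K,
            0 ≤ peakAge (π.path x.1 x.2.1 x.2.2) x.2.1 x.2.2 k := by
          intro k hk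
          obtain ⟨j, rfl⟩ := Nat.exists_eq_succ_of_ne_zero
            (Nat.one_le_iff_ne_zero.1 (Finset.mem_Icc.1 hk).1)
          have h1 := waitTime_nonneg (π.path x.1 x.2.1 x.2.2) x.2.1 x.2.2 j
          have h2 := waitTime_nonneg (π.path x.1 x.2.1 x.2.2) x.2.1 x.2.2 (j + 1)
          have h3 : _ ≤ π.path x.1 x.2.1 x.2.2 j := hπ j x.1 x.2.1 x.2.2 ht hc
          have h4 : π.W j x.1 x.2.1 x.2.2 = waitTime (π.path x.1 x.2.1 x.2.2) x.2.1 x.2.2 j := rfl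
          rw [Nat.succ_eq_add_one, peakAge_succ]
          linarith [ht j, ht (j + 1), hc (j + 1)]
        rw [W, ← ENNReal.ofReal_add (Finset.sum_nonneg hpeak) (waitTime_nonneg _ _ _ _),
          sum_peakAge_add_waitTime, ENNReal.ofReal_sum_of_nonneg]
        · refine Finset.sum_congr rfl fun k _ => ?_
          have h1 := ht k
          have h2 := ht (k + 1)
          have h3 := hc (k + 1)
          have h4 := hcost k
          rw [cost, ← ENNReal.ofReal_add h1.le h2.le, ← ENNReal.ofReal_add (by positivity) h3.le,
            ← ENNReal.ofReal_add (by positivity) h4]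
          rfl
        · intro k _
          have h1 := ht k
          have h2 := ht (k + 1)
          have h3 := hc (k + 1)
          have h4 := hcost k
          exact add_nonneg (by positivity) h4
    _ = _ := by
        have hm := π.measurable_cost
        rw [lintegral_finsetSum _ (fun k _ => by fun_prop)]
        refine Finset.sum_congr rfl fun k _ => ?_
        rw [lintegral_add_right _ (hm k), lintegral_add_right _ (by fun_prop),
          lintegral_add_right _ (by fun_prop), lintegral_transmission, lintegral_transmission,
          lintegral_computation]

/-- A packet sent after computation `k` has started waits at most `C k`, so the boundary term stays
bounded in `K`. -/
theorem lintegral_W_le {π : Policy} (hπ : π.IsFeasible) (hT : ∀ᵐ x ∂μT, 0 < x)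
    (hC : ∀ᵐ x ∂μC, 0 < x) (K : ℕ) :
    ∫⁻ x, ENNReal.ofReal (π.W K x.1 x.2.1 x.2.2) ∂π.jointLaw μT μC ≤
      ∫⁻ y, ENNReal.ofReal y ∂μC := by
  cases K with
  | zero => simp [W, waitTime]
  | succ k =>
    rw [← lintegral_computation (μT := μT) π k]
    refine lintegral_mono_ae ?_
    filter_upwards [π.ae_pos_jointLaw hT hC] with x ⟨ht, hc⟩
    refine ENNReal.ofReal_le_ofReal ?_
    have h : 0 ≤ π.Z k x.1 x.2.1 x.2.2 - x.2.1 k - π.W k x.1 x.2.1 x.2.2 :=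
      lag_nonneg hπ k x.1 ht hc
    rw [W, waitTime_succ]
    refine max_le (hc k).le ?_
    have h' := ht (k + 1)
    unfold W at h
    unfold path at *
    linarith

theorem meanAge_sub_le_meanPeakAge {π : Policy} (hπ : π ∈ feasiblePolicies)
    (hT : ∀ᵐ x ∂μT, 0 < x) (hC : ∀ᵐ x ∂μC, 0 < x) {m : ℝ≥0∞}
    (hm : ∀ θ, m ≤ thresholdCost μT μC θ) {K : ℕ} (hK : K ≠ 0) :
    meanAge μT μC m - (∫⁻ y, ENNReal.ofReal y ∂μC) / K ≤ meanPeakAge μT μC π K := by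
  have hK' : (K : ℝ≥0∞) ≠ 0 := by exact_mod_cast hK
  rw [tsub_le_iff_right, meanPeakAge, ← ENNReal.add_div,
    ENNReal.le_div_iff_mul_le (Or.inl hK') (Or.inl (ENNReal.natCast_ne_top K))]
  refine le_trans ?_ (add_le_add_right (lintegral_W_le hπ.2 hT hC K) _)
  rw [lintegral_peakAge_add_waitTime hπ.2 hT hC]
  calc meanAge μT μC m * K = ∑ _k ∈ Finset.range K, meanAge μT μC m := by simp [mul_comm]
    _ ≤ _ := Finset.sum_le_sum fun k _ =>
      add_le_add_right (le_lintegral_cost hπ hT hC hm k) _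

theorem meanPeakAge_le_meanAge {π : Policy} (hπ : π.IsFeasible) (hT : ∀ᵐ x ∂μT, 0 < x)
    (hC : ∀ᵐ x ∂μC, 0 < x) {m : ℝ≥0∞} (hm : ∀ k, ∫⁻ x, π.cost k x ∂π.jointLaw μT μC ≤ m)
    (K : ℕ) : meanPeakAge μT μC π K ≤ meanAge μT μC m := by
  rw [meanPeakAge]
  refine ENNReal.div_le_of_le_mul ?_
  refine le_self_add.trans ((lintegral_peakAge_add_waitTime hπ hT hC K).le.trans ?_)
  calc _ ≤ ∑ _k ∈ Finset.range K, meanAge μT μC m :=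
        Finset.sum_le_sum fun k _ => add_le_add_right (hm k) _
    _ = meanAge μT μC m * K := by simp [mul_comm]

end Bounds

end Policy

/-! ### Randomized threshold policies -/

/-- The waiting times under the thresholds `θ`. -/
def thresholdWait (θ : ℕ → ℝ≥0∞) (t c : ℕ → ℝ) : ℕ → ℝ
  | 0 => 0
  | k + 1 => max 0 (c k - thresholdLag (θ k) (c k) - t (k + 1))

theorem measurable_thresholdLag_eval (k : ℕ) :
    Measurable fun x : (ℕ → ℝ≥0∞) × (ℕ → ℝ) × (ℕ → ℝ) => thresholdLag (x.1 k) (x.2.2 k) :=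
  measurable_thresholdLag.comp (g := fun x : ℝ≥0∞ × ℝ => thresholdLag x.1 x.2)
    (f := fun x : (ℕ → ℝ≥0∞) × (ℕ → ℝ) × (ℕ → ℝ) => (x.1 k, x.2.2 k)) (by fun_prop)

theorem measurable_thresholdWait (k : ℕ) :
    Measurable fun x : (ℕ → ℝ≥0∞) × (ℕ → ℝ) × (ℕ → ℝ) => thresholdWait x.1 x.2.1 x.2.2 k := by
  cases k with
  | zero => exact measurable_const
  | succ k =>
    have := measurable_thresholdLag_eval k
    unfold thresholdWait
    fun_prop

/-- The randomized threshold policy whose thresholds are i.i.d. with law `ν`. -/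
abbrev thresholdPolicy (ν : Measure ℝ≥0∞) [IsProbabilityMeasure ν] : Policy where
  Seed := ℕ → ℝ≥0∞
  seedSpace := inferInstance
  seedLaw := Measure.infinitePi fun _ => ν
  isProb := inferInstance
  -- The closed form `thresholdWait` avoids a circular definition, as `W` is itself computed from
  -- `Z`.
  Z k θ t c := t k + thresholdWait θ t c k + thresholdLag (θ k) (c k)
  measurable_Z k := by
    have h1 := measurable_thresholdLag_eval k
    have h2 := measurable_thresholdWait k
    fun_prop

section ThresholdPolicy

variable (ν : Measure ℝ≥0∞) [IsProbabilityMeasure ν]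

theorem W_thresholdPolicy (k : ℕ) (θ : ℕ → ℝ≥0∞) (t c : ℕ → ℝ) :
    (thresholdPolicy ν).W k θ t c = thresholdWait θ t c k := by
  induction k with
  | zero => rfl
  | succ k ih =>
    unfold Policy.W at ih ⊢
    rw [waitTime_succ, ih]
    simp only [Policy.path, thresholdWait]
    congr 1
    ring

theorem lag_thresholdPolicy (k : ℕ) (θ : ℕ → ℝ≥0∞) (t c : ℕ → ℝ) :
    (thresholdPolicy ν).lag k θ t c = thresholdLag (θ k) (c k) := by
  unfold Policy.lag
  rw [W_thresholdPolicy]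
  ring

theorem thresholdPolicy_isFeasible : (thresholdPolicy ν).IsFeasible := by
  intro k θ t c _ _
  rw [W_thresholdPolicy]
  have := thresholdLag_nonneg (θ k) (c k)
  dsimp only
  linarith

theorem thresholdPolicy_isCausal : (thresholdPolicy ν).IsCausal := by
  intro k θ t t' c c' _ _ hc hc' ht hcc h
  have hW : thresholdWait θ t c k = thresholdWait θ t' c' k := by
    cases k with
    | zero => rfl
    | succ k => simp only [thresholdWait, ht (k + 1) le_rfl, hcc k (Nat.lt_succ_self k)]
  have hL : thresholdLag (θ k) (c k) = thresholdLag (θ k) (c' k) := by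
    rcases h with h | ⟨h, h'⟩
    · rw [h]
    · rw [lag_thresholdPolicy] at h h'
      exact thresholdLag_congr (hc k) (hc' k) h h'
  simp only [hW, hL, ht k le_rfl]

theorem thresholdPolicy_mem_feasiblePolicies : thresholdPolicy ν ∈ feasiblePolicies :=
  ⟨thresholdPolicy_isCausal ν, thresholdPolicy_isFeasible ν⟩

theorem thresholdPolicy_mem_randomizedThresholdPolicies :
    thresholdPolicy ν ∈ randomizedThresholdPolicies := by
  refine ⟨⟨thresholdPolicy_mem_feasiblePolicies ν, fun k θ t c _ hc => ?_⟩, ν,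
    fun k θ => θ k, fun k => measurable_pi_apply k, fun k => ?_, ?_, fun k θ t c _ _ => ?_⟩
  · rw [W_thresholdPolicy]
    have := thresholdLag_le (θ k) (hc k).le
    dsimp only
    linarith
  · exact Measure.infinitePi_map_eval (fun _ : ℕ => ν) k
  · exact iIndepFun_infinitePi (P := fun _ : ℕ => ν) (X := fun _ x => x)
      (fun _ => measurable_id)
  · rw [W_thresholdPolicy]
    rfl

/-- The cost involves only the coordinates `θ k`, `t (k + 1)` and `c k`, which are independent with
laws not depending on `k`. -/
theorem lintegral_cost_thresholdPolicy {μT μC : Measure ℝ} [IsProbabilityMeasure μT]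
    [IsProbabilityMeasure μC] (k : ℕ) :
    ∫⁻ x, (thresholdPolicy ν).cost k x ∂(thresholdPolicy ν).jointLaw μT μC =
      ∫⁻ θ, thresholdCost μT μC θ ∂ν := by
  have h := (measurePreserving_eval_infinitePi (fun _ : ℕ => ν) k).prod
    ((measurePreserving_eval_infinitePi (fun _ : ℕ => μT) (k + 1)).prod
      (measurePreserving_eval_infinitePi (fun _ : ℕ => μC) k))
  unfold thresholdCost
  rw [← lintegral_prod _ measurable_thresholdCost.aemeasurable,
    ← h.lintegral_comp measurable_thresholdCost]
  refine lintegral_congr fun x => ?_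
  rw [Policy.cost, lag_thresholdPolicy]
  rfl

end ThresholdPolicy

end MEC

end

theorem theorem1 (μT μC : Measure ℝ) [IsProbabilityMeasure μT] [IsProbabilityMeasure μC]
    (hT_pos : ∀ᵐ x ∂μT, 0 < x) (hC_pos : ∀ᵐ x ∂μC, 0 < x)
    (hT_mean : Integrable (fun x : ℝ => x) μT) (hC_mean : Integrable (fun x : ℝ => x) μC) :
    ∃ π ∈ MEC.randomizedThresholdPolicies, MEC.IsOptimal μT μC π := by
  obtain ⟨θ, hθ⟩ := MEC.exists_thresholdCost_le hT_pos hC_pos hC_mean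
  have hm := MEC.thresholdCost_ne_top hT_pos hC_pos hC_mean θ
  have hlim := MEC.Policy.tendsto_meanAge_sub (μT := μT) hC_mean (MEC.thresholdCost μT μC θ)
  have hlower : ∀ π ∈ MEC.feasiblePolicies, ∀ᶠ K : ℕ in atTop,
      MEC.Policy.meanAge μT μC (MEC.thresholdCost μT μC θ)
        - (∫⁻ y, ENNReal.ofReal y ∂μC) / K ≤ MEC.meanPeakAge μT μC π K := fun π hπ =>
    (eventually_ne_atTop 0).mono fun K hK =>
      MEC.Policy.meanAge_sub_le_meanPeakAge hπ hT_pos hC_pos hθ hK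
  have hfin : MEC.Policy.meanAge μT μC (MEC.thresholdCost μT μC θ) ≠ ⊤ := by
    have h1 := MEC.lintegral_ofReal_ne_top hT_mean
    have h2 := MEC.lintegral_ofReal_ne_top hC_mean
    simp [MEC.Policy.meanAge, h1, h2, hm]
  -- A constant threshold already attains the minimum, so the common law of the thresholds can be a
  -- point mass.
  have hπ := MEC.thresholdPolicy_mem_feasiblePolicies (Measure.dirac θ)
  refine ⟨MEC.thresholdPolicy (Measure.dirac θ),
    MEC.thresholdPolicy_mem_randomizedThresholdPolicies _, hπ,
    (MEC.Policy.meanAge μT μC (MEC.thresholdCost μT μC θ)).toNNReal, ?_, fun π' hπ' => ?_⟩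
  · rw [ENNReal.coe_toNNReal hfin]
    refine tendsto_of_tendsto_of_tendsto_of_le_of_le' hlim tendsto_const_nhds
      (hlower _ hπ) (Eventually.of_forall fun K => ?_)
    refine MEC.Policy.meanPeakAge_le_meanAge hπ.2 hT_pos hC_pos (fun k => ?_) K
    rw [MEC.lintegral_cost_thresholdPolicy,
      lintegral_dirac' _ (MEC.continuous_thresholdCost hT_pos hC_pos hC_mean).measurable]
  · rw [ENNReal.coe_toNNReal hfin, ← hlim.liminf_eq]
    exact liminf_le_liminf (hlower π' hπ')
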